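/- Let $K$ be a field of positive characteristic. A variety of Lie algebras over $K$ is the class of all Lie algebras over $K$ satisfying some set of polynomial identities (Lie polynomials in countably many variables). A variety $\mathfrak V$ is called locally finite if in every algebra of $\mathfrak V$ each finitely generated subalgebra is finite-dimensional over $K$. The ordinal function $f_{\mathfrak V}:\{1,2,\ldots\}\to\{0,1,2,\ldots\}$ of a locally finite variety $\mathfrak V$ is defined by $f_{\mathfrak V}(n)=\dim_K F_n(\mathfrak V)$, where $F_n(\mathfrak V)$ is the relatively free algebra of rank $n$ in $\mathfrak V$, that is, the quotient of the free Lie algebra over $K$ on $n$ generators by the ideal of all its elements which are identities of every algebra in $\mathfrak V$. Then there exists a set of varieties of Lie algebras over $K$, of the cardinality of the continuum, such that every variety in the set is locally finite and any two distinct varieties in the set have different ordinal functions. -/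

import Mathlib

universe u

/-- A Lie polynomial `f` in the variables `x₀, x₁, …` is a polynomial identity of the Lie
algebra `L` if it vanishes under every substitution of elements of `L` for the variables. -/
def IsLieIdentity {K : Type u} [Field K] {X : Type} (f : FreeLieAlgebra K X)
    (L : Type u) [LieRing L] [LieAlgebra K L] : Prop :=
  ∀ v : X → L, FreeLieAlgebra.lift K v f = 0

/-- A variety of Lie algebras over `K`: a class of Lie algebras which consists of all Lie algebras
satisfying some set of polynomial identities. -/
structure LieVariety (K : Type u) [Field K] where
  /-- Membership of a Lie algebra in the variety. -/
  Mem : (L : Type u) → [LieRing L] → [LieAlgebra K L] → Prop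
  /-- The variety is the class of all algebras satisfying some set of identities. -/
  exists_identities : ∃ S : Set (FreeLieAlgebra K ℕ),
    ∀ (L : Type u) [LieRing L] [LieAlgebra K L], Mem L ↔ ∀ f ∈ S, IsLieIdentity f L

namespace LieVariety

variable {K : Type u} [Field K]

/-- A variety is locally finite if in each of its algebras every finitely generated subalgebra is
finite-dimensional. -/
def IsLocallyFinite (V : LieVariety K) : Prop :=
  ∀ (L : Type u) [LieRing L] [LieAlgebra K L], V.Mem L →
    ∀ s : Finset L, FiniteDimensional K (LieSubalgebra.lieSpan K L (s : Set L))

/-- The ideal of the free Lie algebra on `X` of all Lie polynomials which are identities of every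
algebra of the variety. -/
def identityIdeal (V : LieVariety K) (X : Type) : LieIdeal K (FreeLieAlgebra K X) where
  carrier := {f | ∀ (L : Type u) [LieRing L] [LieAlgebra K L], V.Mem L → IsLieIdentity f L}
  add_mem' := by
    intro a b ha hb L _ _ hL v
    rw [map_add, ha L hL v, hb L hL v, add_zero]
  zero_mem' := by
    intro L _ _ _ v
    exact map_zero _
  smul_mem' := by
    intro c a ha L _ _ hL v
    rw [map_smul, ha L hL v, smul_zero]
  lie_mem := by
    intro x a ha L _ _ hL v
    rw [LieHom.map_lie, ha L hL v, lie_zero]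

/-- The relatively free algebra of the variety on the set `X` of free generators. -/
abbrev RelFree (V : LieVariety K) (X : Type) : Type u :=
  FreeLieAlgebra K X ⧸ V.identityIdeal X

/-- The ordinal function `n ↦ dim F_n(V)`, `n = 1, 2, …`, where `F_n(V)` is the relatively free
algebra of rank `n`; meaningful for locally finite varieties, where these dimensions are finite. -/
noncomputable def ordinalFunction (V : LieVariety K) (n : ℕ+) : ℕ :=
  Module.finrank K (V.RelFree (Fin n))

end LieVariety

/-! Let `R` be the polynomial ring over `K` modulo `X₀ ^ (p + 1)` and `Xᵢ ^ p` for `i ≥ 1`. The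
operators `a * X * d/dX` and `b * X` act on the abelian algebra `R[X]`. In the semidirect product,
take the subalgebra where `a` is a linear form and constant coefficients of polynomials are scalars.
In characteristic `p` the derivation `X * d/dX` kills `X ^ p`, so any `K`-subspace of `R` may be
prescribed for the `p`-th coefficients of an ideal of polynomials divisible by `X ^ p`. `TopAlgebra
K p n` is the quotient in which, of that coefficient, only the part at `X₀ ^ p * X₁ * ⋯ * Xₙ`
survives.

The values of `testCommutator (p - 1) n` start with `X ^ p` times `g * r ^ p`, where `g` is a form
of degree `n` and `r` has no constant term. Frobenius collapses `r ^ p` to a multiple of `X₀ ^ p`,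
so this coefficient has degree `n + p`. By degrees the commutator is an identity of `TopAlgebra K p
m` for every `m ≠ n`; a direct substitution shows that it fails for `m = n`
(`testCommutator_mem_commonIdentities`, `testCommutator_testPoint_mem_iff`).

Hence the variety generated by the algebras with `n ∈ T` grows strictly with `T`. It is locally
finite: finitely many Euler coefficients generate a nilpotent ideal, which kills long right-normed
commutators. For nested locally finite varieties, an identity in `n` variables that separates them
makes the ordinal functions differ at `n` (`ordinalFunction_lt`). This compares nested varieties
only, so the family is indexed by a chain of continuum many subsets of `ℕ`, the Dedekind cuts. -/

/-! ### Right-normed commutators and finite generation -/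

section RightNormed

variable {K : Type*} [CommRing K] {L M : Type*} [LieRing L] [LieAlgebra K L]
  [LieRing M] [LieAlgebra K M]

/-- The right-normed commutator `⁅x₁, ⁅x₂, … ⁅xₙ, y⁆ … ⁆⁆`. -/
def rightNormed (l : List L) (y : L) : L := l.foldr (fun x u => ⁅x, u⁆) y

theorem map_rightNormed (f : L →ₗ⁅K⁆ M) (l : List L) (y : L) :
    f (rightNormed l y) = rightNormed (l.map f) (f y) := by
  induction l with
  | nil => rfl
  | cons x l ih => simpa [rightNormed] using congrArg (fun u => ⁅f x, u⁆) ih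

theorem rightNormed_append (l l' : List L) (y : L) :
    rightNormed (l ++ l') y = rightNormed l (rightNormed l' y) := by
  simp [rightNormed]

theorem rightNormed_zero (l : List L) : rightNormed l (0 : L) = 0 := by
  induction l with
  | nil => rfl
  | cons x l ih => simpa [rightNormed] using congrArg (fun u => ⁅x, u⁆) ih

/-- The right-normed commutators with entries in `s`. -/
def rightNormedSet (s : Set L) : Set L :=
  {u | ∃ l : List L, (∀ x ∈ l, x ∈ s) ∧ ∃ y ∈ s, u = rightNormed l y}

theorem lie_mem_span_rightNormedSet_of_mem (s : Set L) {x : L} (hx : x ∈ s) {u : L}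
    (hu : u ∈ Submodule.span K (rightNormedSet s)) :
    ⁅x, u⁆ ∈ Submodule.span K (rightNormedSet s) := by
  induction hu using Submodule.span_induction with
  | mem u hu =>
    obtain ⟨l, hl, y, hy, rfl⟩ := hu
    refine Submodule.subset_span ⟨x :: l, ?_, y, hy, rfl⟩
    simpa [hx] using hl
  | zero => simp
  | add u v _ _ hu hv => rw [lie_add]; exact add_mem hu hv
  | smul c u _ hu => rw [lie_smul]; exact Submodule.smul_mem _ _ hu

/-- The Jacobi identity rewrites `ad ⁅x, w'⁆` as a commutator of `ad x` and `ad w'`, so the left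
factor can be peeled off letter by letter. -/
theorem lie_mem_span_rightNormedSet (s : Set L) {w u : L}
    (hw : w ∈ Submodule.span K (rightNormedSet s))
    (hu : u ∈ Submodule.span K (rightNormedSet s)) :
    ⁅w, u⁆ ∈ Submodule.span K (rightNormedSet s) := by
  induction hw using Submodule.span_induction with
  | mem w hw =>
    obtain ⟨l, hl, y, hy, rfl⟩ := hw
    induction l generalizing u with
    | nil => exact lie_mem_span_rightNormedSet_of_mem s hy hu
    | cons x l ih =>
      have hx : x ∈ s := hl x (by simp)
      have hl' : ∀ z ∈ l, z ∈ s := fun z hz => hl z (by simp [hz])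
      change ⁅⁅x, rightNormed l y⁆, u⁆ ∈ _
      rw [lie_lie]
      exact sub_mem (lie_mem_span_rightNormedSet_of_mem s hx (ih hu hl'))
        (ih (lie_mem_span_rightNormedSet_of_mem s hx hu) hl')
  | zero => simp
  | add w v _ _ hw hv => rw [add_lie]; exact add_mem hw hv
  | smul c w _ hw => rw [smul_lie]; exact Submodule.smul_mem _ _ hw

theorem lieSpan_le_span_rightNormedSet (s : Set L) :
    (LieSubalgebra.lieSpan K L s).toSubmodule ≤ Submodule.span K (rightNormedSet s) := by
  let S : LieSubalgebra K L :=
    { Submodule.span K (rightNormedSet s) with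
      lie_mem' := fun hx hy => lie_mem_span_rightNormedSet s hx hy }
  have : LieSubalgebra.lieSpan K L s ≤ S := by
    rw [LieSubalgebra.lieSpan_le]
    exact fun x hx => Submodule.subset_span ⟨[], by simp, x, hx, rfl⟩
  exact this

end RightNormed

/-- A Lie algebra generated by a finite set whose long right-normed commutators vanish is
finite-dimensional. -/
theorem finiteDimensional_lieSpan_of_rightNormed_eq_zero {K L : Type*} [Field K] [LieRing L]
    [LieAlgebra K L] (s : Set L) (hs : s.Finite) (N : ℕ)
    (h : ∀ l : List L, (∀ x ∈ l, x ∈ s) → ∀ y ∈ s, l.length = N → rightNormed l y = 0) :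
    FiniteDimensional K (LieSubalgebra.lieSpan K L s) := by
  have hfin : {l : List L | l.length ≤ N ∧ ∀ x ∈ l, x ∈ s}.Finite := by
    have := hs.to_subtype
    refine ((List.finite_length_le s N).image (List.map Subtype.val)).subset ?_
    rintro l ⟨hl, hm⟩
    lift l to List s using hm
    exact ⟨l, by simpa using hl, rfl⟩
  have hfin' := (hfin.prod hs).image (fun q : List L × L => rightNormed q.1 q.2)
  have hle : Submodule.span K (rightNormedSet s) ≤ Submodule.span K
      ((fun q : List L × L => rightNormed q.1 q.2) ''
        ({l : List L | l.length ≤ N ∧ ∀ x ∈ l, x ∈ s} ×ˢ s)) := by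
    rw [Submodule.span_le]
    rintro _ ⟨l, hl, y, hy, rfl⟩
    by_cases hN : l.length ≤ N
    · exact Submodule.subset_span ⟨(l, y), ⟨⟨hN, hl⟩, hy⟩, rfl⟩
    -- The innermost `N` entries applied to `y` already give zero.
    · have hz : rightNormed l y = 0 := by
        rw [← List.take_append_drop (l.length - N) l, rightNormed_append,
          h (l.drop _) (fun x hx => hl x (List.mem_of_mem_drop hx)) y hy
            (by rw [List.length_drop]; omega), rightNormed_zero]
      rw [hz]
      exact zero_mem _
  have := FiniteDimensional.span_of_finite K hfin'
  exact Submodule.finiteDimensional_of_le ((lieSpan_le_span_rightNormedSet s).trans hle)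

/-! ### Free and relatively free algebras, ordinal functions -/

namespace FreeLieAlgebra

theorem lift_comp_lift {K : Type*} [CommRing K] {X Y L : Type*} [LieRing L] [LieAlgebra K L]
    (w : Y → L) (v : X → FreeLieAlgebra K Y) (f : FreeLieAlgebra K X) :
    lift K w (lift K v f) = lift K (fun i => lift K w (v i)) f := by
  have : (lift K w).comp (lift K v) = lift K (fun i => lift K w (v i)) := by
    ext i; simp
  exact DFunLike.congr_fun this f

theorem map_lift {K : Type*} [CommRing K] {X L M : Type*} [LieRing L] [LieAlgebra K L]
    [LieRing M] [LieAlgebra K M] (g : L →ₗ⁅K⁆ M) (v : X → L) (f : FreeLieAlgebra K X) :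
    g (lift K v f) = lift K (fun i => g (v i)) f := by
  have : g.comp (lift K v) = lift K (fun i => g (v i)) := by
    ext i; simp
  exact DFunLike.congr_fun this f

theorem lieSpan_range_of (K : Type*) [CommRing K] (X : Type*) :
    LieSubalgebra.lieSpan K (FreeLieAlgebra K X) (Set.range (of K)) = ⊤ := by
  let S := LieSubalgebra.lieSpan K (FreeLieAlgebra K X) (Set.range (of K))
  let v : X → S := fun i => ⟨of K i, LieSubalgebra.subset_lieSpan ⟨i, rfl⟩⟩
  have h : S.incl.comp (lift K v) = LieHom.id := by
    ext i; simp [v]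
  rw [eq_top_iff]
  intro f _
  have := DFunLike.congr_fun h f
  simp only [LieHom.comp_apply, LieHom.id_apply] at this
  rw [← this]
  exact (lift K v f).2

end FreeLieAlgebra

/-- The quotient map of a Lie ideal as a homomorphism of Lie algebras. -/
def LieIdeal.quotientHom {K L : Type*} [CommRing K] [LieRing L] [LieAlgebra K L]
    (I : LieIdeal K L) : L →ₗ⁅K⁆ L ⧸ I :=
  { (LieSubmodule.Quotient.mk' I : L →ₗ[K] L ⧸ I) with
    map_lie' := fun {x y} => LieSubmodule.Quotient.mk_bracket (I := I) x y }

theorem LieIdeal.quotientHom_eq_zero {K L : Type*} [CommRing K] [LieRing L] [LieAlgebra K L]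
    (I : LieIdeal K L) {x : L} : I.quotientHom x = 0 ↔ x ∈ I :=
  LieSubmodule.Quotient.mk_eq_zero'

namespace LieVariety

variable {K : Type u} [Field K]

theorem mem_identityIdeal {V : LieVariety K} {X : Type} {f : FreeLieAlgebra K X} :
    f ∈ V.identityIdeal X ↔
      ∀ (L : Type u) [LieRing L] [LieAlgebra K L], V.Mem L → IsLieIdentity f L := Iff.rfl

/-- Substituting into a defining identity yields another identity of the variety; lifting the
substituted values to the free algebra reduces to this. -/
theorem mem_relFree (V : LieVariety K) (X : Type) : V.Mem (V.RelFree X) := by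
  obtain ⟨S, hS⟩ := V.exists_identities
  rw [hS]
  intro f hf v
  choose w hw using fun i => LieSubmodule.Quotient.surjective_mk' (V.identityIdeal X) (v i)
  have hv : v = fun i => LieSubmodule.Quotient.mk' (V.identityIdeal X) (w i) :=
    funext fun i => (hw i).symm
  have h1 : FreeLieAlgebra.lift K v f =
      LieSubmodule.Quotient.mk' (V.identityIdeal X) (FreeLieAlgebra.lift K w f) := by
    rw [hv]
    exact (FreeLieAlgebra.map_lift (V.identityIdeal X).quotientHom w f).symm
  rw [h1, ← LieModuleHom.mem_ker, LieSubmodule.Quotient.mk'_ker, mem_identityIdeal]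
  intro L _ _ hL u
  rw [FreeLieAlgebra.lift_comp_lift]
  exact (hS L).1 hL f hf _

theorem IsLocallyFinite.finiteDimensional_relFree {V : LieVariety K} (hV : V.IsLocallyFinite)
    (X : Type) [Finite X] : FiniteDimensional K (V.RelFree X) := by
  let q := (V.identityIdeal X).quotientHom
  have hq : Function.Surjective q := LieSubmodule.Quotient.surjective_mk' (V.identityIdeal X)
  let s : Set (V.RelFree X) := Set.range fun i => q (FreeLieAlgebra.of K i)
  have hs : s.Finite := Set.finite_range _
  have htop : LieSubalgebra.lieSpan K (V.RelFree X) s = ⊤ := by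
    rw [eq_top_iff]
    intro x _
    obtain ⟨f, rfl⟩ := hq x
    have hle : LieSubalgebra.lieSpan K (FreeLieAlgebra K X) (Set.range (FreeLieAlgebra.of K)) ≤
        (LieSubalgebra.lieSpan K (V.RelFree X) s).comap q := by
      rw [LieSubalgebra.lieSpan_le]
      rintro _ ⟨i, rfl⟩
      exact LieSubalgebra.subset_lieSpan (R := K) (L := V.RelFree X) (s := s) ⟨i, rfl⟩
    rw [FreeLieAlgebra.lieSpan_range_of] at hle
    exact hle (LieSubalgebra.mem_top f)
  have := hV (V.RelFree X) (V.mem_relFree X) hs.toFinset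
  rw [hs.coe_toFinset, htop] at this
  exact Module.Finite.equiv (LieSubalgebra.topEquiv (R := K) (L := V.RelFree X)).toLinearEquiv

/-- A proper inclusion of varieties, witnessed by an identity in `n` variables, makes the ordinal
function strictly smaller at `n`. -/
theorem ordinalFunction_lt {V W : LieVariety K} (hW : W.IsLocallyFinite)
    (hVW : ∀ (L : Type u) [LieRing L] [LieAlgebra K L], V.Mem L → W.Mem L)
    (n : ℕ+) {f : FreeLieAlgebra K (Fin n)}
    (hfV : f ∈ V.identityIdeal (Fin n)) (hfW : f ∉ W.identityIdeal (Fin n)) :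
    V.ordinalFunction n < W.ordinalFunction n := by
  have := hW.finiteDimensional_relFree (Fin n)
  have hle : (W.identityIdeal (Fin n)).toSubmodule ≤ (V.identityIdeal (Fin n)).toSubmodule :=
    fun g hg L _ _ hL => hg L (hVW L hL)
  let φ : W.RelFree (Fin n) →ₗ[K] V.RelFree (Fin n) := Submodule.factor hle
  have hφ : Function.Surjective φ := Submodule.factor_surjective hle
  have hker : 0 < Module.finrank K (LinearMap.ker φ) := by
    rw [Module.finrank_pos_iff_exists_ne_zero]
    refine ⟨⟨Submodule.Quotient.mk f, ?_⟩, ?_⟩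
    · exact (Submodule.Quotient.mk_eq_zero _).2 hfV
    · intro h
      exact hfW ((Submodule.Quotient.mk_eq_zero _).1 (congrArg Subtype.val h))
  have h1 := φ.finrank_range_add_finrank_ker
  rw [LinearMap.range_eq_top.2 hφ, finrank_top] at h1
  unfold ordinalFunction
  omega

end LieVariety

/-! ### The truncated polynomial ring -/

namespace TruncatedRing

open MvPolynomial

variable (K : Type u) [Field K] (p : ℕ)

/-- Exponents of the generators of the truncation ideal. -/
def exponents : Set (ℕ →₀ ℕ) :=
  {e | e = Finsupp.single 0 (p + 1) ∨ ∃ i : ℕ, e = Finsupp.single (i + 1) p}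

/-- The ideal generated by `X₀ ^ (p + 1)` and all `Xᵢ ^ p`, `i ≥ 1`. -/
noncomputable def truncation : Ideal (MvPolynomial ℕ K) :=
  Ideal.span ((fun e => monomial e (1 : K)) '' exponents p)

/-- The exponent of `X₀ ^ p * X₁ * ⋯ * Xₙ`. -/
noncomputable def topExponent (n : ℕ) : ℕ →₀ ℕ :=
  Finsupp.single 0 p + ∑ i ∈ Finset.range n, Finsupp.single (i + 1) 1

theorem topExponent_zero (n : ℕ) : topExponent p n 0 = p := by
  simp [topExponent]

theorem topExponent_succ_le (n i : ℕ) : topExponent p n (i + 1) ≤ 1 := by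
  simp only [topExponent, Finsupp.add_apply, Finsupp.finsetSum_apply, Finsupp.single_apply]
  simp only [Nat.add_right_cancel_iff, Finset.sum_ite_eq']
  split_ifs <;> simp_all

theorem degree_topExponent (n : ℕ) : (topExponent p n).degree = p + n := by
  simp [topExponent, Finsupp.degree_single, map_sum]

variable {p}

/-- The ideal is monomial and no generator divides `X₀ ^ p * X₁ * ⋯ * Xₙ`, so this coefficient is
well defined on the quotient. -/
theorem coeff_topExponent_of_mem (hp : 2 ≤ p) (n : ℕ) {f : MvPolynomial ℕ K}
    (hf : f ∈ truncation K p) : coeff (topExponent p n) f = 0 := by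
  by_contra h
  obtain ⟨e, he, hle⟩ := (mem_ideal_span_monomial_image.1 hf) _ (mem_support_iff.2 h)
  rcases he with rfl | ⟨i, rfl⟩
  · have := hle 0
    rw [topExponent_zero] at this
    simp at this
  · have := hle (i + 1)
    have h2 := topExponent_succ_le p n i
    simp at this
    omega

theorem prod_X_mul_X_pow (n : ℕ) :
    (∏ i ∈ Finset.range n, (X (i + 1) : MvPolynomial ℕ K)) * X 0 ^ p =
      monomial (topExponent p n) 1 := by
  have h : ∏ i ∈ Finset.range n, (X (i + 1) : MvPolynomial ℕ K) =
      monomial (∑ i ∈ Finset.range n, Finsupp.single (i + 1) 1) 1 := by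
    rw [monomial_sum_one]; rfl
  rw [h, X_pow_eq_monomial, monomial_mul, topExponent, add_comm, one_mul]

end TruncatedRing

/-- The polynomial ring in countably many variables modulo `X₀ ^ (p + 1)` and all `Xᵢ ^ p`. -/
abbrev TruncatedRing (K : Type u) [Field K] (p : ℕ) : Type u :=
  MvPolynomial ℕ K ⧸ TruncatedRing.truncation K p

namespace TruncatedRing

open MvPolynomial

variable (K : Type u) [Field K] (p : ℕ)

/-- The canonical generators. -/
noncomputable def gen (i : ℕ) : TruncatedRing K p := Ideal.Quotient.mk _ (X i)

/-- The images of the linear forms. -/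
noncomputable def linearForms : Submodule K (TruncatedRing K p) :=
  (homogeneousSubmodule ℕ K 1).map (Ideal.Quotient.mkₐ K (truncation K p)).toLinearMap

/-- The elements with vanishing coefficient at `X₀ ^ p * X₁ * ⋯ * Xₙ`. -/
noncomputable def topKernel (n : ℕ) : Submodule K (TruncatedRing K p) :=
  (LinearMap.ker (lcoeff K (topExponent p n))).map
    (Ideal.Quotient.mkₐ K (truncation K p)).toLinearMap

variable {K p}

theorem mk_mem_topKernel (hp : 2 ≤ p) {n : ℕ} {f : MvPolynomial ℕ K} :
    (Ideal.Quotient.mk _ f : TruncatedRing K p) ∈ topKernel K p n ↔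
      coeff (topExponent p n) f = 0 := by
  constructor
  · rintro ⟨g, hg, hgf⟩
    have h1 : g - f ∈ truncation K p := Ideal.Quotient.eq.1 hgf
    have h2 := coeff_topExponent_of_mem K hp n h1
    rw [coeff_sub, sub_eq_zero] at h2
    rw [← h2]
    exact hg
  · exact fun h => ⟨f, h, rfl⟩

theorem gen_mem_linearForms (i : ℕ) : gen K p i ∈ linearForms K p :=
  ⟨X i, isHomogeneous_X K i, rfl⟩

theorem gen_zero_pow : gen K p 0 ^ (p + 1) = 0 := by
  rw [gen, ← map_pow, Ideal.Quotient.eq_zero_iff_mem, X_pow_eq_monomial]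
  exact Ideal.subset_span ⟨_, Or.inl rfl, rfl⟩

theorem gen_succ_pow (i : ℕ) : gen K p (i + 1) ^ p = 0 := by
  rw [gen, ← map_pow, Ideal.Quotient.eq_zero_iff_mem, X_pow_eq_monomial]
  exact Ideal.subset_span ⟨_, Or.inr ⟨i, rfl⟩, rfl⟩

theorem gen_pow_mul_gen_zero_pow (hp : 2 ≤ p) (i : ℕ) : gen K p i ^ p * gen K p 0 ^ p = 0 := by
  cases i with
  | zero =>
    rw [← pow_add, show p + p = (p + 1) + (p - 1) by omega, pow_add, gen_zero_pow, zero_mul]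
  | succ i => rw [gen_succ_pow, zero_mul]

theorem prod_gen_mul_gen_zero_pow_notMem (hp : 2 ≤ p) (n : ℕ) :
    (∏ i ∈ Finset.range n, gen K p (i + 1)) * gen K p 0 ^ p ∉ topKernel K p n := by
  have : (∏ i ∈ Finset.range n, gen K p (i + 1)) * gen K p 0 ^ p =
      Ideal.Quotient.mk _ (monomial (topExponent p n) (1 : K)) := by
    rw [← prod_X_mul_X_pow]; simp [gen]
  rw [this, mk_mem_topKernel hp]
  simp

theorem nontrivial (hp : 2 ≤ p) : Nontrivial (TruncatedRing K p) := by
  refine nontrivial_of_ne ((∏ i ∈ Finset.range 0, gen K p (i + 1)) * gen K p 0 ^ p) 0 fun h => ?_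
  exact prod_gen_mul_gen_zero_pow_notMem hp 0 (h ▸ zero_mem _)

theorem charP (hp : 2 ≤ p) [CharP K p] : CharP (TruncatedRing K p) p := by
  have := nontrivial (K := K) hp
  exact charP_of_injective_algebraMap (algebraMap K (TruncatedRing K p)).injective p

variable (K p) in
/-- The ideal of elements without constant term. -/
noncomputable def augmentation : Ideal (TruncatedRing K p) := Ideal.span (Set.range (gen K p))

theorem linearForms_le_augmentation {a : TruncatedRing K p} (ha : a ∈ linearForms K p) :
    a ∈ augmentation K p := by
  obtain ⟨f, hf, rfl⟩ := ha
  rw [SetLike.mem_coe, homogeneousSubmodule_one_eq_span_X] at hf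
  induction hf using Submodule.span_induction with
  | mem x hx =>
    obtain ⟨i, rfl⟩ := hx
    exact Ideal.subset_span ⟨i, rfl⟩
  | zero => simp
  | add x y _ _ hx hy => rw [map_add]; exact add_mem hx hy
  | smul c x _ hx => rw [map_smul]; exact Submodule.smul_of_tower_mem _ c hx

/-- Frobenius is additive and the `p`-th power of each generator annihilates `X₀ ^ p`, so only the
constant term of `r` contributes. -/
theorem exists_pow_mul_gen_zero_pow (hp : p.Prime) [CharP K p] (r : TruncatedRing K p) :
    ∃ α : K, r ^ p * gen K p 0 ^ p = α • gen K p 0 ^ p := by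
  have := charP (K := K) hp.two_le
  have : Fact p.Prime := ⟨hp⟩
  obtain ⟨f, rfl⟩ := Ideal.Quotient.mk_surjective r
  induction f using MvPolynomial.induction_on with
  | C a =>
    refine ⟨a ^ p, ?_⟩
    change algebraMap K (TruncatedRing K p) a ^ p * _ = _
    rw [← map_pow, ← Algebra.smul_def]
  | add f g hf hg =>
    obtain ⟨α, hα⟩ := hf
    obtain ⟨β, hβ⟩ := hg
    exact ⟨α + β, by rw [map_add, add_pow_char, add_mul, hα, hβ, add_smul]⟩
  | mul_X f i hf =>
    refine ⟨0, ?_⟩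
    rw [map_mul, mul_pow, mul_assoc]
    exact (congrArg _ (gen_pow_mul_gen_zero_pow hp.two_le i)).trans (by simp)

theorem exists_pow_eq (hp : p.Prime) [CharP K p] {r : TruncatedRing K p}
    (hr : r ∈ augmentation K p) : ∃ α : K, r ^ p = α • gen K p 0 ^ p := by
  have := charP (K := K) hp.two_le
  have : Fact p.Prime := ⟨hp⟩
  induction hr using Submodule.span_induction with
  | mem x hx =>
    obtain ⟨i, rfl⟩ := hx
    cases i with
    | zero => exact ⟨1, by simp⟩
    | succ i => exact ⟨0, by simp [gen_succ_pow]⟩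
  | zero => exact ⟨0, by simp [hp.ne_zero]⟩
  | add x y _ _ hx hy =>
    obtain ⟨α, hα⟩ := hx
    obtain ⟨β, hβ⟩ := hy
    exact ⟨α + β, by rw [add_pow_char, hα, hβ, add_smul]⟩
  | smul c x _ hx =>
    obtain ⟨α, hα⟩ := hx
    obtain ⟨β, hβ⟩ := exists_pow_mul_gen_zero_pow hp c
    exact ⟨α * β, by rw [smul_eq_mul, mul_pow, hα, mul_smul_comm, hβ, smul_smul]⟩

theorem pow_two_mul_eq_zero (hp : p.Prime) [CharP K p] {r : TruncatedRing K p}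
    (hr : r ∈ augmentation K p) : r ^ (p * 2) = 0 := by
  obtain ⟨α, hα⟩ := exists_pow_eq hp hr
  rw [pow_mul, hα, sq, smul_mul_smul_comm, gen_pow_mul_gen_zero_pow hp.two_le, smul_zero]

theorem linearForms_pow_le (m : ℕ) :
    linearForms K p ^ m ≤ (homogeneousSubmodule ℕ K m).map
      (Ideal.Quotient.mkₐ K (truncation K p)).toLinearMap := by
  rw [linearForms, ← Submodule.map_pow]
  refine Submodule.map_mono ?_
  induction m with
  | zero =>
    rw [pow_zero, Submodule.one_le]
    exact isHomogeneous_one ℕ K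
  | succ m ih =>
    rw [pow_succ]
    exact (mul_le_mul_left ih _).trans (homogeneousSubmodule_mul m 1)

/-- The product is a multiple of a form of degree `m` times `X₀ ^ p`, while the tested monomial has
degree `n + p`. -/
theorem mul_pow_mem_topKernel (hp : p.Prime) [CharP K p] {m n : ℕ} (hmn : m ≠ n)
    {g : TruncatedRing K p} (hg : g ∈ linearForms K p ^ m) {r : TruncatedRing K p}
    (hr : r ∈ augmentation K p) : g * r ^ p ∈ topKernel K p n := by
  obtain ⟨α, hα⟩ := exists_pow_eq hp hr
  obtain ⟨f, hf, rfl⟩ := linearForms_pow_le m hg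
  rw [hα, mul_smul_comm]
  refine Submodule.smul_mem _ _ ?_
  have hh : (f * X 0 ^ p).IsHomogeneous (m + 1 * p) :=
    IsHomogeneous.mul hf ((isHomogeneous_X K 0).pow p)
  change (Ideal.Quotient.mk _ (f * X 0 ^ p) : TruncatedRing K p) ∈ _
  rw [mk_mem_topKernel hp.two_le]
  refine hh.coeff_eq_zero ?_
  rw [degree_topExponent]
  omega

end TruncatedRing

/-! ### The Euler extension: bracket, weights, ideals -/

open Polynomial

/-- The space `R × R × R[X]`, with the Lie bracket of the semidirect product of the derivations
`a * X * d/dX` and the multiplications by `b * X` with the abelian algebra `R[X]`. -/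
def EulerExtension (R : Type*) [CommRing R] : Type _ := R × R × R[X]

namespace EulerExtension

section Basic

variable {R : Type*} [CommRing R]

noncomputable instance : AddCommGroup (EulerExtension R) :=
  inferInstanceAs (AddCommGroup (R × R × R[X]))

noncomputable instance {K : Type*} [CommRing K] [Algebra K R] : Module K (EulerExtension R) :=
  inferInstanceAs (Module K (R × R × R[X]))

/-- The coefficient of the Euler derivation. -/
def euler (x : EulerExtension R) : R := x.1

/-- The coefficient of the multiplication operator. -/
def mult (x : EulerExtension R) : R := x.2.1

/-- The component in the abelian ideal `R[X]`. -/
def poly (x : EulerExtension R) : R[X] := x.2.2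

@[ext]
theorem ext {x y : EulerExtension R} (h₁ : x.euler = y.euler) (h₂ : x.mult = y.mult)
    (h₃ : x.poly = y.poly) : x = y :=
  Prod.ext h₁ (Prod.ext h₂ h₃)

@[simp] theorem euler_add (x y : EulerExtension R) : (x + y).euler = x.euler + y.euler := rfl
@[simp] theorem mult_add (x y : EulerExtension R) : (x + y).mult = x.mult + y.mult := rfl
@[simp] theorem poly_add (x y : EulerExtension R) : (x + y).poly = x.poly + y.poly := rfl
@[simp] theorem euler_zero : (0 : EulerExtension R).euler = 0 := rfl
@[simp] theorem mult_zero : (0 : EulerExtension R).mult = 0 := rfl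
@[simp] theorem poly_zero : (0 : EulerExtension R).poly = 0 := rfl

section

variable {K : Type*} [CommRing K] [Algebra K R]

@[simp] theorem euler_smul (c : K) (x : EulerExtension R) : (c • x).euler = c • x.euler := rfl
@[simp] theorem mult_smul (c : K) (x : EulerExtension R) : (c • x).mult = c • x.mult := rfl
@[simp] theorem poly_smul (c : K) (x : EulerExtension R) : (c • x).poly = c • x.poly := rfl

end

noncomputable instance : Bracket (EulerExtension R) (EulerExtension R) where
  bracket x y := (0, x.euler * y.mult - y.euler * x.mult,
    C x.euler * X * derivative y.poly + C x.mult * X * y.poly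
      - C y.euler * X * derivative x.poly - C y.mult * X * x.poly)

@[simp] theorem euler_lie (x y : EulerExtension R) : ⁅x, y⁆.euler = 0 := rfl

@[simp] theorem mult_lie (x y : EulerExtension R) :
    ⁅x, y⁆.mult = x.euler * y.mult - y.euler * x.mult := rfl

@[simp] theorem poly_lie (x y : EulerExtension R) :
    ⁅x, y⁆.poly = C x.euler * X * derivative y.poly + C x.mult * X * y.poly
      - C y.euler * X * derivative x.poly - C y.mult * X * x.poly := rfl

noncomputable instance : LieRing (EulerExtension R) where
  add_lie x y z := by ext1 <;> simp <;> ring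
  lie_add x y z := by ext1 <;> simp <;> ring
  lie_self x := by ext1 <;> simp
  leibniz_lie x y z := by
    ext1
    · simp
    · simp; ring
    · simp; ring

noncomputable instance {K : Type*} [CommRing K] [Algebra K R] :
    LieAlgebra K (EulerExtension R) where
  lie_smul c x y := by
    ext1
    · simp
    · simp [smul_sub]
    · have hC : ∀ r : R, C (c • r) = c • C r := fun r => (smul_C c r).symm
      simp only [poly_lie, euler_smul, mult_smul, poly_smul, derivative_smul, hC,
        smul_mul_assoc, mul_smul_comm, smul_sub, smul_add]

theorem coeff_poly_lie_zero (x y : EulerExtension R) : ⁅x, y⁆.poly.coeff 0 = 0 := by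
  simp [mul_assoc]

theorem coeff_poly_lie_succ (x y : EulerExtension R) (j : ℕ) :
    ⁅x, y⁆.poly.coeff (j + 1) =
      x.euler * (y.poly.coeff (j + 1) * (j + 1)) + x.mult * y.poly.coeff j
      - y.euler * (x.poly.coeff (j + 1) * (j + 1)) - y.mult * x.poly.coeff j := by
  simp [mul_assoc, coeff_X_mul, coeff_derivative]

/-- The elements of `J`-adic weight at least `s`. -/
def weightSet (J : Ideal R) (s : ℕ) : Set (EulerExtension R) :=
  {u | u.euler = 0 ∧ u.mult ∈ J ^ s ∧ ∀ j, u.poly.coeff j ∈ J ^ (s - j)}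

/-- The Euler part of `x` contributes a factor from `J`; the multiplication part raises the degree
in `X` instead. Either way the weight, with `X` counted as one, goes up. -/
theorem lie_mem_weightSet {J : Ideal R} {s : ℕ} {x u : EulerExtension R} (hx : x.euler ∈ J)
    (hu : u ∈ weightSet J s) : ⁅x, u⁆ ∈ weightSet J (s + 1) := by
  obtain ⟨h1, h2, h3⟩ := hu
  refine ⟨by simp, ?_, ?_⟩
  · rw [mult_lie, h1, zero_mul, sub_zero, pow_succ']
    exact Ideal.mul_mem_mul hx h2
  · intro j
    cases j with
    | zero =>
      rw [coeff_poly_lie_zero]; exact zero_mem _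
    | succ j =>
      rw [coeff_poly_lie_succ, h1, zero_mul, sub_zero, show s + 1 - (j + 1) = s - j by omega]
      refine sub_mem (add_mem ?_ (Ideal.mul_mem_left _ _ (h3 j))) (Ideal.mul_mem_right _ _ ?_)
      · refine Ideal.pow_le_pow_right (show s - j ≤ s - (j + 1) + 1 by omega) ?_
        rw [pow_succ']
        exact Ideal.mul_mem_mul hx (Ideal.mul_mem_right _ _ (h3 (j + 1)))
      · exact Ideal.pow_le_pow_right (by omega) h2

theorem rightNormed_mem_weightSet {J : Ideal R} (l : List (EulerExtension R))
    (hl : ∀ x ∈ l, x.euler ∈ J) (y : EulerExtension R) (h : l ≠ []) :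
    rightNormed l y ∈ weightSet J (l.length - 1) := by
  induction l with
  | nil => exact absurd rfl h
  | cons x l ih =>
    by_cases hn : l = []
    · subst hn
      -- The first bracket only clears the Euler coefficient; it has weight `0`, hence `l.length -
      -- 1`.
      exact ⟨by simp [rightNormed], by simp, by simp⟩
    · have := lie_mem_weightSet (hl x (by simp)) (ih (fun z hz => hl z (by simp [hz])) hn)
      have hpos := List.length_pos_iff.2 hn
      rwa [show l.length - 1 + 1 = (x :: l).length - 1 by simp; omega] at this

end Basic

section Subalgebra

variable {K R : Type*} [CommRing K] [CommRing R] [Algebra K R]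

/-- The subalgebra of elements with Euler coefficient in `T` and constant coefficient in `K`. -/
noncomputable def restricted (T : Submodule K R) : LieSubalgebra K (EulerExtension R) where
  carrier := {x | x.euler ∈ T ∧ ∃ k : K, x.poly.coeff 0 = algebraMap K R k}
  add_mem' := by
    rintro x y ⟨hx, k, hk⟩ ⟨hy, l, hl⟩
    exact ⟨add_mem hx hy, k + l, by simp [hk, hl]⟩
  zero_mem' := ⟨zero_mem _, 0, by simp⟩
  smul_mem' := by
    rintro c x ⟨hx, k, hk⟩
    exact ⟨T.smul_mem c hx, c * k, by simp [hk, Algebra.smul_def]⟩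
  lie_mem' := by
    intro x y _ _
    exact ⟨zero_mem _, 0, by rw [coeff_poly_lie_zero, map_zero]⟩

/-- The ideal of polynomials divisible by `X ^ p` with `p`-th coefficient in `W`. -/
noncomputable def tailIdeal (p : ℕ) [CharP R p] (W : Submodule K R) :
    LieIdeal K (EulerExtension R) where
  carrier := {x | x.euler = 0 ∧ x.mult = 0 ∧ (∀ j < p, x.poly.coeff j = 0) ∧ x.poly.coeff p ∈ W}
  add_mem' := by
    rintro x y ⟨hx1, hx2, hx3, hx4⟩ ⟨hy1, hy2, hy3, hy4⟩
    refine ⟨by simp [hx1, hy1], by simp [hx2, hy2], fun j hj => by simp [hx3 j hj, hy3 j hj], ?_⟩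
    rw [poly_add, coeff_add]
    exact add_mem hx4 hy4
  zero_mem' := ⟨rfl, rfl, by simp, by simp⟩
  smul_mem' := by
    rintro c x ⟨hx1, hx2, hx3, hx4⟩
    refine ⟨by simp [hx1], by simp [hx2], fun j hj => by simp [hx3 j hj], ?_⟩
    rw [poly_smul, coeff_smul]
    exact W.smul_mem c hx4
  lie_mem := by
    rintro x y ⟨hy1, hy2, hy3, hy4⟩
    -- Even the `p`-th coefficient vanishes, since `X * d/dX` multiplies it by `p = 0`; therefore
    -- `W` need not be stable under `R`.
    have key : ∀ j ≤ p, ⁅x, y⁆.poly.coeff j = 0 := by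
      intro j hj
      cases j with
      | zero => exact coeff_poly_lie_zero x y
      | succ j =>
        rw [coeff_poly_lie_succ, hy1, hy2, hy3 j (by omega)]
        rcases hj.lt_or_eq with h | h
        · simp [hy3 _ h]
        · have : ((j : R) + 1) = 0 := by
            rw [← Nat.cast_add_one, h, CharP.cast_eq_zero]
          simp [this]
    refine ⟨by simp, by simp [hy1, hy2], fun j hj => key j hj.le, ?_⟩
    rw [key p le_rfl]
    exact zero_mem W

end Subalgebra

end EulerExtension

/-! ### The separating commutators and their values -/

section Word

variable {K : Type*} [CommRing K] {L M : Type*} [LieRing L] [LieAlgebra K L]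
  [LieRing M] [LieAlgebra K M]

/-- The commutator `(ad w) ^ k ad z₁ ⋯ ad zₙ ad w y`, where `w = ⁅v 0, v 1⁆`, `y = v 2` and
`zᵢ = v (i + 2)`. -/
def testCommutator (k n : ℕ) (v : ℕ → L) : L :=
  rightNormed (List.replicate k ⁅v 0, v 1⁆ ++ (List.range n).map fun i => v (i + 3))
    ⁅⁅v 0, v 1⁆, v 2⁆

theorem map_testCommutator (f : L →ₗ⁅K⁆ M) (k n : ℕ) (v : ℕ → L) :
    f (testCommutator k n v) = testCommutator k n fun i => f (v i) := by
  simp [testCommutator, map_rightNormed, Function.comp_def]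

theorem testCommutator_congr (k n : ℕ) {v v' : ℕ → L} (h : ∀ i < n + 3, v i = v' i) :
    testCommutator k n v = testCommutator k n v' := by
  have h1 : ((List.range n).map fun i => v (i + 3)) = (List.range n).map fun i => v' (i + 3) :=
    List.map_congr_left fun i hi => h _ (by have := List.mem_range.1 hi; omega)
  rw [testCommutator, testCommutator, h1, h 0 (by omega), h 1 (by omega), h 2 (by omega)]

end Word

namespace EulerExtension

variable {R : Type*} [CommRing R]

/-- The shape of the commutators `ad z₁ ⋯ ad zₙ ad w y`, where `w` is a commutator with
polynomial component `X * q`. -/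
def HasShape (w : EulerExtension R) (q : R[X]) (e g : R) (u : EulerExtension R) : Prop :=
  u.euler = 0 ∧ u.mult = -(e * w.mult) ∧
    ∃ r : R[X], u.poly = X * (C (w.mult * g) - C e * q) + X ^ 2 * r

theorem hasShape_lie {w : EulerExtension R} {q : R[X]} (hw : w.euler = 0) (hq : w.poly = X * q)
    (y : EulerExtension R) : HasShape w q y.euler (y.poly.coeff 0) ⁅w, y⁆ := by
  refine ⟨by simp, by simp [hw], C w.mult * divX y.poly - C y.euler * derivative q
    - C y.mult * q, ?_⟩
  rw [poly_lie, hw, hq]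
  nth_rw 2 [← divX_mul_X_add y.poly]
  simp
  ring

theorem HasShape.lie {w u : EulerExtension R} {q : R[X]} {e g : R} (hu : HasShape w q e g u)
    (z : EulerExtension R) :
    HasShape w q (z.euler * e) (z.euler * g + e * z.poly.coeff 0) ⁅z, u⁆ := by
  obtain ⟨h1, h2, r, h3⟩ := hu
  refine ⟨by simp, by simp [h1, h2, mul_assoc], C z.euler * (2 * r + X * derivative r)
    - C z.euler * C e * derivative q + C z.mult * (C (w.mult * g) - C e * q + X * r)
    + C (e * w.mult) * divX z.poly, ?_⟩
  rw [poly_lie, h1, h2, h3]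
  simp
  linear_combination -(C e * C w.mult * X) * divX_mul_X_add z.poly

/-- Degrees in `T` are tracked here. Constant coefficients are scalars, so the term `e' *
z.poly.coeff 0` has exactly the degree required of the new `g'`. -/
theorem HasShape.rightNormed_mem {K : Type*} [CommRing K] [Algebra K R] {T : Submodule K R}
    {w u : EulerExtension R} {q : R[X]} {e g : R} {n : ℕ} (hu : HasShape w q e g u)
    (he : e ∈ T ^ (n + 1)) (hg : g ∈ T ^ n) (l : List (EulerExtension R))
    (hl : ∀ z ∈ l, z ∈ restricted T) :
    ∃ e' ∈ T ^ (l.length + n + 1), ∃ g' ∈ T ^ (l.length + n),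
      HasShape w q e' g' (rightNormed l u) := by
  induction l with
  | nil => exact ⟨e, by simpa using he, g, by simpa using hg, hu⟩
  | cons z l ih =>
    obtain ⟨e', he', g', hg', h⟩ := ih fun x hx => hl x (by simp [hx])
    obtain ⟨hz, k, hk⟩ := hl z (by simp)
    refine ⟨z.euler * e', ?_, z.euler * g' + e' * z.poly.coeff 0, ?_, h.lie z⟩
    · rw [List.length_cons, show l.length + 1 + n + 1 = (l.length + n + 1) + 1 by omega, pow_succ']
      exact Submodule.mul_mem_mul hz he'
    · rw [List.length_cons, show l.length + 1 + n = (l.length + n) + 1 by omega]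
      refine add_mem ?_ ?_
      · rw [pow_succ']
        exact Submodule.mul_mem_mul hz hg'
      · rw [hk, mul_comm, ← Algebra.smul_def]
        exact Submodule.smul_mem _ _ he'

/-- The first `ad w` cancels the unwanted term `e * q` against the contribution of `u.mult = -(e *
w.mult)`. Each later one merely multiplies by `w.mult * X`. -/
theorem HasShape.exists_poly_rightNormed_replicate {w u : EulerExtension R} {q : R[X]} {e g : R}
    (hw : w.euler = 0) (hq : w.poly = X * q) (hu : HasShape w q e g u) (k : ℕ) :
    (rightNormed (List.replicate (k + 1) w) u).euler = 0 ∧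
    (rightNormed (List.replicate (k + 1) w) u).mult = 0 ∧
    ∃ r : R[X], (rightNormed (List.replicate (k + 1) w) u).poly =
      X ^ (k + 2) * (C (g * w.mult ^ (k + 2)) + X * r) := by
  induction k with
  | zero =>
    obtain ⟨h1, h2, r, h3⟩ := hu
    change ⁅w, u⁆.euler = 0 ∧ ⁅w, u⁆.mult = 0 ∧ ∃ r : R[X], ⁅w, u⁆.poly = _
    refine ⟨by simp, by simp [hw, h1], C w.mult * r, ?_⟩
    rw [poly_lie, hw, h1, h2, h3, hq]
    simp
    ring
  | succ k ih =>
    obtain ⟨h1, h2, r, h3⟩ := ih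
    rw [List.replicate_succ]
    set u' := rightNormed (List.replicate (k + 1) w) u
    change ⁅w, u'⁆.euler = 0 ∧ ⁅w, u'⁆.mult = 0 ∧ ∃ r : R[X], ⁅w, u'⁆.poly = _
    refine ⟨by simp, by simp [hw, h1], C w.mult * r, ?_⟩
    rw [poly_lie, hw, h1, h2, h3]
    simp
    ring

theorem mem_tailIdeal_iff_of_poly_eq {K : Type*} [CommRing K] [Algebra K R] {p : ℕ} [CharP R p]
    {W : Submodule K R} {u : EulerExtension R} (h1 : u.euler = 0) (h2 : u.mult = 0) {g : R}
    {r : R[X]} (h3 : u.poly = X ^ p * (C g + X * r)) : u ∈ tailIdeal p W ↔ g ∈ W := by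
  have hlow : ∀ j < p, u.poly.coeff j = 0 := fun j hj => by
    rw [h3, coeff_X_pow_mul', if_neg (by omega)]
  have hp : u.poly.coeff p = g := by
    rw [h3, coeff_X_pow_mul', if_pos le_rfl]; simp
  constructor
  · rintro ⟨-, -, -, h⟩
    rwa [hp] at h
  · intro h
    exact ⟨h1, h2, hlow, by rwa [hp]⟩

theorem exists_poly_lie_eq_X_mul (x y : EulerExtension R) : ∃ q : R[X], ⁅x, y⁆.poly = X * q :=
  ⟨C x.euler * derivative y.poly + C x.mult * y.poly - C y.euler * derivative x.poly
    - C y.mult * x.poly, by rw [poly_lie]; ring⟩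

/-- The test commutator takes values in the tail ideal if the relevant products lie in `W`. -/
theorem testCommutator_mem_tailIdeal {K : Type*} [CommRing K] [Algebra K R] {p : ℕ} [CharP R p]
    (hp : 2 ≤ p) {T W : Submodule K R} {n : ℕ}
    (hW : ∀ g ∈ T ^ n, ∀ a₁ ∈ T, ∀ a₂ ∈ T, ∀ b₁ b₂ : R, g * (a₁ * b₂ - a₂ * b₁) ^ p ∈ W)
    (v : ℕ → EulerExtension R) (hv : ∀ i, v i ∈ restricted T) :
    testCommutator (p - 1) n v ∈ tailIdeal p W := by
  -- The `p - 1 = k + 1` outer copies of `ad w` produce the leading power `X ^ (k + 2) = X ^ p`.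
  obtain ⟨k, rfl⟩ : ∃ k, p = k + 2 := ⟨p - 2, by omega⟩
  obtain ⟨q, hq⟩ := exists_poly_lie_eq_X_mul (v 0) (v 1)
  have hw := euler_lie (v 0) (v 1)
  have h0 : (v 2).poly.coeff 0 ∈ T ^ 0 := by
    obtain ⟨-, c, hc⟩ := hv 2
    rw [hc, pow_zero]
    exact Submodule.algebraMap_mem c
  obtain ⟨e, -, g, hg, h⟩ := (hasShape_lie hw hq (v 2)).rightNormed_mem (T := T) (n := 0)
    (by simpa using (hv 2).1) h0 ((List.range n).map fun i => v (i + 3)) (by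
      intro z hz
      obtain ⟨i, -, rfl⟩ := List.mem_map.1 hz
      exact hv _)
  obtain ⟨h1, h2, r, h3⟩ := h.exists_poly_rightNormed_replicate hw hq k
  rw [testCommutator, rightNormed_append]
  refine (mem_tailIdeal_iff_of_poly_eq h1 h2 h3).2 ?_
  rw [mult_lie]
  exact hW g (by simpa using hg) _ (hv 0).1 _ (hv 1).1 _ _

/-- A substitution witnessing that the test commutator is not an identity. -/
noncomputable def testPoint (a : R) (c : ℕ → R) : ℕ → EulerExtension R
  | 0 => (a, 0, 0)
  | 1 => (0, 1, 0)
  | 2 => (0, 0, 1)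
  | i + 3 => (c i, 0, 0)

theorem testPoint_mem_restricted {K : Type*} [CommRing K] [Algebra K R] {T : Submodule K R}
    {a : R} (ha : a ∈ T) {c : ℕ → R} (hc : ∀ i, c i ∈ T) (i : ℕ) :
    testPoint a c i ∈ restricted T := by
  match i with
  | 0 => exact ⟨ha, 0, by simp [testPoint, poly]⟩
  | 1 => exact ⟨zero_mem T, 0, by simp [testPoint, poly]⟩
  | 2 => exact ⟨zero_mem T, 1, by simp [testPoint, poly]⟩
  | i + 3 => exact ⟨hc i, 0, by simp [testPoint, poly]⟩

theorem testCommutator_testPoint_mem_iff {K : Type*} [CommRing K] [Algebra K R] {p : ℕ}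
    [CharP R p] (hp : 2 ≤ p) {W : Submodule K R} (n : ℕ) (a : R) (c : ℕ → R) :
    testCommutator (p - 1) n (testPoint a c) ∈ tailIdeal p W ↔
      (∏ i ∈ Finset.range n, c i) * a ^ p ∈ W := by
  obtain ⟨k, rfl⟩ : ∃ k, p = k + 2 := ⟨p - 2, by omega⟩
  obtain ⟨q, hq⟩ := exists_poly_lie_eq_X_mul (testPoint a c 0) (testPoint a c 1)
  have hw := euler_lie (testPoint a c 0) (testPoint a c 1)
  set w := ⁅testPoint a c 0, testPoint a c 1⁆ with hwdef
  have hm : w.mult = a := by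
    rw [hwdef, mult_lie]; simp [testPoint, euler, mult]
  have h20 : (testPoint a c 2).euler = 0 := rfl
  have h21 : (testPoint a c 2).poly.coeff 0 = 1 := coeff_one_zero
  have hshape : ∀ l : List ℕ, HasShape w q 0 (l.map c).prod
      (rightNormed (l.map fun i => testPoint a c (i + 3)) ⁅w, testPoint a c 2⁆) := by
    intro l
    induction l with
    | nil =>
      have := hasShape_lie hw hq (testPoint a c 2)
      rwa [h20, h21] at this
    | cons i l ih =>
      have := ih.lie (testPoint a c (i + 3))
      rw [mul_zero, zero_mul, add_zero] at this
      exact this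
  obtain ⟨h1, h2, r, h3⟩ := (hshape (List.range n)).exists_poly_rightNormed_replicate hw hq k
  rw [hm] at h3
  have hprod : ((List.range n).map c).prod = ∏ i ∈ Finset.range n, c i := by
    clear h1 h2 h3
    induction n with
    | zero => rfl
    | succ n ih => rw [List.range_succ, Finset.prod_range_succ, ← ih]; simp
  rw [testCommutator, rightNormed_append, ← hprod]
  exact mem_tailIdeal_iff_of_poly_eq h1 h2 h3

end EulerExtension

/-! ### Nilpotency of long commutators -/

/-- Pigeonhole on the `k` generators, done by induction. The extra `1` serves `k = 0`, where the
zero ideal needs a positive exponent. -/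
theorem Ideal.span_image_Iio_pow_eq_bot {R : Type*} [CommRing R] {m : ℕ} {c : ℕ → R}
    (hc : ∀ i, c i ^ m = 0) (k : ℕ) : Ideal.span (c '' Set.Iio k) ^ (m * k + 1) = ⊥ := by
  rw [eq_bot_iff]
  induction k with
  | zero => simp
  | succ k ih =>
    rw [← Order.succ_eq_add_one, Order.Iio_succ_eq_insert, Set.image_insert_eq, Ideal.span_insert,
      Order.succ_eq_add_one, show m * (k + 1) + 1 = m + (m * k + 1) by ring]
    refine Ideal.sup_pow_add_le_pow_sup_pow.trans (sup_le ?_ ih)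
    rw [Ideal.span_singleton_pow, hc, Ideal.span_singleton_eq_bot.2 rfl]

namespace EulerExtension

/-- The weight is at least `N + p`, so all coefficients up to degree `p` lie in `J ^ N = ⊥`. -/
theorem rightNormed_mem_tailIdeal {K R : Type*} [CommRing K] [CommRing R] [Algebra K R] {p : ℕ}
    [CharP R p] {W : Submodule K R} {J : Ideal R} {N : ℕ} (hJ : J ^ N = ⊥)
    (l : List (EulerExtension R)) (hl : ∀ x ∈ l, x.euler ∈ J) (hlen : N + p + 1 ≤ l.length)
    (y : EulerExtension R) : rightNormed l y ∈ tailIdeal p W := by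
  obtain ⟨h1, h2, h3⟩ := rightNormed_mem_weightSet l hl y
    (List.length_pos_iff.1 (by omega))
  have hbot : ∀ {M : ℕ} {r : R}, N ≤ M → r ∈ J ^ M → r = 0 := fun hM hr => by
    have := Ideal.pow_le_pow_right hM hr
    rwa [hJ, Ideal.mem_bot] at this
  have hcoeff : ∀ j ≤ p, (rightNormed l y).poly.coeff j = 0 :=
    fun j hj => hbot (by omega) (h3 j)
  refine ⟨h1, hbot (by omega) h2, fun j hj => hcoeff j hj.le, ?_⟩
  rw [hcoeff p le_rfl]
  exact zero_mem W

end EulerExtension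

/-! ### The varieties indexed by sets of natural numbers -/

open EulerExtension TruncatedRing

instance TruncatedRing.instCharP (K : Type u) [Field K] (p : ℕ) [Fact p.Prime] [CharP K p] :
    CharP (TruncatedRing K p) p :=
  TruncatedRing.charP (Fact.out : p.Prime).two_le

section Family

variable (K : Type u) [Field K] (p : ℕ) [Fact p.Prime] [CharP K p]

/-- The ideal of the Euler extension of the truncated ring that isolates the monomial
`X₀ ^ p * X₁ * ⋯ * Xₙ`. -/
noncomputable abbrev topIdeal (n : ℕ) : LieIdeal K (EulerExtension (TruncatedRing K p)) :=
  tailIdeal p (topKernel K p n)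

/-- The subalgebra with linear Euler coefficients and scalar constant coefficients. -/
noncomputable abbrev linearPart : LieSubalgebra K (EulerExtension (TruncatedRing K p)) :=
  restricted (linearForms K p)

/-- The quotient of `linearPart` by the ideal isolating `X₀ ^ p * X₁ * ⋯ * Xₙ`. -/
abbrev TopAlgebra (n : ℕ) : Type u :=
  linearPart K p ⧸ (topIdeal K p n).comap (linearPart K p).incl

variable {K p}

theorem lift_quotientHom_eq_zero_iff {X : Type*} (n : ℕ) (w : X → linearPart K p)
    (f : FreeLieAlgebra K X) :
    FreeLieAlgebra.lift K
      (fun i => ((topIdeal K p n).comap (linearPart K p).incl).quotientHom (w i)) f = 0 ↔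
      FreeLieAlgebra.lift K (fun i => (w i : EulerExtension (TruncatedRing K p))) f ∈
        topIdeal K p n := by
  rw [← FreeLieAlgebra.map_lift, LieIdeal.quotientHom_eq_zero, LieIdeal.mem_comap,
    FreeLieAlgebra.map_lift]
  rfl

variable (K p)

/-- The common identities of the algebras `TopAlgebra K p n`, `n ∈ T`. -/
def commonIdentities (T : Set ℕ) : Set (FreeLieAlgebra K ℕ) :=
  {f | ∀ n ∈ T, ∀ v : ℕ → EulerExtension (TruncatedRing K p), (∀ i, v i ∈ linearPart K p) →
    FreeLieAlgebra.lift K v f ∈ topIdeal K p n}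

/-- The variety generated by the algebras `TopAlgebra K p n`, `n ∈ T`. -/
def topVariety (T : Set ℕ) : LieVariety K where
  Mem L _ _ := ∀ f ∈ commonIdentities K p T, IsLieIdentity f L
  exists_identities := ⟨commonIdentities K p T, fun _ _ _ => Iff.rfl⟩

variable {K p}

theorem topVariety_mono {T T' : Set ℕ} (h : T ⊆ T') (L : Type u) [LieRing L] [LieAlgebra K L]
    (hL : (topVariety K p T).Mem L) : (topVariety K p T').Mem L :=
  fun f hf => hL f fun n hn => hf n (h hn)

theorem topAlgebra_mem {T : Set ℕ} {n : ℕ} (hn : n ∈ T) :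
    (topVariety K p T).Mem (TopAlgebra K p n) := by
  intro f hf v
  let I := (topIdeal K p n).comap (linearPart K p).incl
  choose w hw using fun i => LieSubmodule.Quotient.surjective_mk' I (v i)
  have hv : v = fun i => I.quotientHom (w i) := funext fun i => (hw i).symm
  rw [hv, lift_quotientHom_eq_zero_iff]
  exact hf n hn _ fun i => (w i).2

/-- The Euler coefficients of `k` elements have vanishing `2p`-th powers, so they generate an ideal
with zero power `p * 2 * k + 1`. The length does not depend on `T`. -/
theorem rightNormed_mem_commonIdentities (T : Set ℕ) (k : ℕ) (l : List ℕ) (hl : ∀ i ∈ l, i < k)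
    (hlen : l.length = p * 2 * k + 1 + p + 1) (j : ℕ) :
    rightNormed (l.map (FreeLieAlgebra.of K)) (FreeLieAlgebra.of K j) ∈
      commonIdentities K p T := by
  intro n _ v hv
  rw [map_rightNormed]
  have hp : p.Prime := Fact.out
  have hJ := Ideal.span_image_Iio_pow_eq_bot (m := p * 2) (c := fun i => (v i).euler)
    (fun i => pow_two_mul_eq_zero hp (linearForms_le_augmentation (hv i).1)) k
  refine rightNormed_mem_tailIdeal hJ _ ?_ (by simp [hlen]) _
  intro x hx
  simp only [List.map_map, List.mem_map, Function.comp_apply, FreeLieAlgebra.lift_of_apply] at hx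
  obtain ⟨i, hi, rfl⟩ := hx
  exact Ideal.subset_span ⟨i, hl i hi, rfl⟩

theorem topVariety_isLocallyFinite (T : Set ℕ) : (topVariety K p T).IsLocallyFinite := by
  classical
  intro L _ _ hL s
  refine finiteDimensional_lieSpan_of_rightNormed_eq_zero (s : Set L) s.finite_toSet
    (p * 2 * s.card + 1 + p + 1) ?_
  intro l hl y hy hlen
  let v : ℕ → L := fun i => s.toList.getD i 0
  let idx : L → ℕ := fun x => s.toList.idxOf x
  have hidx : ∀ x ∈ s, idx x < s.card := fun x hx => by
    rw [← Finset.length_toList]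
    exact List.idxOf_lt_length_iff.2 (Finset.mem_toList.2 hx)
  have hv : ∀ x ∈ s, v (idx x) = x := fun x hx => by
    have hlt : s.toList.idxOf x < s.toList.length := by
      rw [Finset.length_toList]; exact hidx x hx
    simp only [v, idx]
    rw [List.getD_eq_getElem _ _ hlt, List.getElem_idxOf]
  have h := hL _ (rightNormed_mem_commonIdentities T s.card (l.map idx) (by
    intro i hi
    obtain ⟨x, hx, rfl⟩ := List.mem_map.1 hi
    exact hidx x (hl x hx)) (by simpa using hlen) (idx y)) v
  rw [map_rightNormed, FreeLieAlgebra.lift_of_apply, hv y hy, List.map_map, List.map_map] at h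
  rw [← h]
  congr 1
  conv_lhs => rw [← List.map_id l]
  exact List.map_congr_left fun x hx => by simp [hv x (hl x hx)]

theorem testCommutator_mem_commonIdentities {T : Set ℕ} {n : ℕ} (hn : n ∉ T) :
    testCommutator (p - 1) n (FreeLieAlgebra.of K) ∈ commonIdentities K p T := by
  have hp : p.Prime := Fact.out
  intro m hm v hv
  rw [map_testCommutator]
  simp only [FreeLieAlgebra.lift_of_apply]
  refine testCommutator_mem_tailIdeal hp.two_le ?_ v hv
  intro g hg a₁ ha₁ a₂ ha₂ b₁ b₂
  have hne : n ≠ m := by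
    rintro rfl
    exact hn hm
  exact mul_pow_mem_topKernel hp hne hg
    (sub_mem (Ideal.mul_mem_right _ _ (linearForms_le_augmentation ha₁))
      (Ideal.mul_mem_right _ _ (linearForms_le_augmentation ha₂)))

theorem topVariety_ordinalFunction_ne {T T' : Set ℕ} (h : T ⊆ T') {n : ℕ} (hn : n ∉ T)
    (hn' : n ∈ T') :
    (topVariety K p T).ordinalFunction ≠ (topVariety K p T').ordinalFunction := by
  have hp : p.Prime := Fact.out
  -- The test commutator involves exactly the variables with index below `n + 3`; the value `0`
  -- beyond them is never read.
  let N : ℕ+ := ⟨n + 3, by omega⟩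
  let x : ℕ → FreeLieAlgebra K (Fin N) :=
    fun i => if hi : i < n + 3 then FreeLieAlgebra.of K ⟨i, hi⟩ else 0
  refine fun heq => (LieVariety.ordinalFunction_lt (topVariety_isLocallyFinite T')
    (fun L _ _ hL => topVariety_mono h L hL) N (f := testCommutator (p - 1) n x) ?_ ?_).ne
    (congrFun heq N)
  · intro L _ _ hL u
    rw [map_testCommutator]
    have := hL _ (testCommutator_mem_commonIdentities hn) fun i => FreeLieAlgebra.lift K u (x i)
    rw [map_testCommutator] at this
    simpa only [FreeLieAlgebra.lift_of_apply] using this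
  · intro hmem
    have hg : ∀ i, gen K p i ∈ linearForms K p := fun i => gen_mem_linearForms i
    have hP : ∀ i, testPoint (gen K p 0) (fun i => gen K p (i + 1)) i ∈ linearPart K p :=
      testPoint_mem_restricted (T := linearForms K p) (hg 0) fun i => hg (i + 1)
    let P : ℕ → linearPart K p := fun i => ⟨_, hP i⟩
    have hid : IsLieIdentity (testCommutator (p - 1) n x) (TopAlgebra K p n) :=
      hmem (TopAlgebra K p n) (topAlgebra_mem hn')
    have h0 := (lift_quotientHom_eq_zero_iff n (fun i : Fin N => P i) _).1 (hid _)
    rw [map_testCommutator,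
      testCommutator_congr (v' := testPoint (gen K p 0) (fun i => gen K p (i + 1))),
      testCommutator_testPoint_mem_iff hp.two_le] at h0
    · exact prod_gen_mul_gen_zero_pow_notMem hp.two_le n h0
    · intro i hi
      simp only [x, dif_pos hi, FreeLieAlgebra.lift_of_apply, P]

end Family

/-! ### A chain of continuum many sets of natural numbers -/

/-- The codes of the rational numbers below `r`. -/
def lowerCut (r : ℝ) : Set ℕ := {n | ∃ q : ℚ, Encodable.encode q = n ∧ (q : ℝ) < r}

theorem lowerCut_mono {r r' : ℝ} (h : r ≤ r') : lowerCut r ⊆ lowerCut r' :=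
  fun _ ⟨q, hq, hr⟩ => ⟨q, hq, hr.trans_le h⟩

theorem exists_mem_lowerCut_notMem {r r' : ℝ} (h : r < r') :
    ∃ n, n ∉ lowerCut r ∧ n ∈ lowerCut r' := by
  obtain ⟨q, hq, hq'⟩ := exists_rat_btwn h
  refine ⟨Encodable.encode q, ?_, q, rfl, hq'⟩
  rintro ⟨q', he, hr⟩
  rw [Encodable.encode_injective he] at hr
  exact lt_asymm hq hr

theorem topVariety_lowerCut_ordinalFunction_injective (K : Type u) [Field K] (p : ℕ)
    [Fact p.Prime] [CharP K p] :
    Function.Injective fun r : ℝ => (topVariety K p (lowerCut r)).ordinalFunction := by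
  refine Function.Injective.of_lt_imp_ne fun r r' h => ?_
  obtain ⟨n, hn, hn'⟩ := exists_mem_lowerCut_notMem h
  exact topVariety_ordinalFunction_ne (lowerCut_mono h.le) hn hn'

theorem corollary3 (K : Type u) [Field K] (p : ℕ) (hp : 0 < p) [CharP K p] :
    ∃ 𝒱 : Set (LieVariety K),
      Cardinal.mk 𝒱 = Cardinal.continuum ∧
      (∀ V ∈ 𝒱, V.IsLocallyFinite) ∧
      (∀ V ∈ 𝒱, ∀ W ∈ 𝒱, V ≠ W → V.ordinalFunction ≠ W.ordinalFunction) := by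
  have : Fact p.Prime := ⟨(CharP.char_is_prime_or_zero K p).resolve_right hp.ne'⟩
  have hinj := topVariety_lowerCut_ordinalFunction_injective K p
  refine ⟨Set.range fun r : ℝ => topVariety K p (lowerCut r), ?_, ?_, ?_⟩
  · have hinj' : Function.Injective fun r : ℝ => topVariety K p (lowerCut r) :=
      fun r r' h => hinj (congrArg LieVariety.ordinalFunction h)
    have := Cardinal.mk_range_eq_of_injective hinj'
    rwa [Cardinal.mk_real, Cardinal.lift_continuum, Cardinal.lift_uzero] at this
  · rintro _ ⟨r, rfl⟩
    exact topVariety_isLocallyFinite _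
  · rintro _ ⟨r, rfl⟩ _ ⟨r', rfl⟩ hne heq
    exact hne (congrArg (fun r : ℝ => topVariety K p (lowerCut r)) (hinj heq))
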